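/- Let $\mathcal X\subset\mathbb R^d$ be a compact set of positive volume $V$, let $\sigma>0$, and let $\mathcal F$ be a nonempty class of measurable functions $f:\mathcal X\to[0,1]$. For $f\in\mathcal F$ let $P_f$ be the probability distribution on $\mathcal X\times\mathbb R$ with density $p_f(x,y)=V^{-1}\,\mathcal N(y;f(x),\sigma^2)$, where $\mathcal N(\cdot\,;m,\sigma^2)$ is the normal density with mean $m$ and variance $\sigma^2$ (so under $P_f$, $X$ is uniform on $\mathcal X$ and $Y=f(X)+Z$ with $Z\sim\mathrm{Normal}(0,\sigma^2)$ independent of $X$), and let $\mathcal P=\{P_f:f\in\mathcal F\}$. For a probability distribution $P$ on $\mathcal X\times\mathbb R$ and $D\ge 0$, the conditional rate-distortion function for the squared loss is $$R_{Y|X}(D,P)=\inf\bigl\{\,I(Y;\hat Y\mid X)\;:\;(X,Y)\sim P,\ \mathbb E\,|Y-\hat Y|^2\le D\,\bigr\},$$ the infimum being over all real-valued random variables $\hat Y$ jointly distributed with $(X,Y)$, and $I(Y;\hat Y\mid X)$ being the conditional mutual information in bits. The conditional distortion-rate function is its inverse, $D_{Y|X}(R,P)=\inf\{D\ge 0: R_{Y|X}(D,P)\le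 R\}$, and $\mathbb D_{Y|X}(R,\mathcal P)=\sup_{P\in\mathcal P}D_{Y|X}(R,P)$. Then for every $R\ge 0$: 1. $D_{Y|X}(R,P_f)=\sigma^2\,2^{-2R}$ for every $f\in\mathcal F$; in particular it does not depend on $f$; 2. $\mathbb D_{Y|X}(R,\mathcal P)=\sigma^2\,2^{-2R}$. -/

import Mathlib

open MeasureTheory ProbabilityTheory InformationTheory
open scoped ENNReal NNReal

noncomputable section

namespace CondRateDistortion

/-- The conditional mutual information `I(U; V | W)`, in bits, of random variables on a probability
space `(Ω, μ)`: the divergence of the joint law of `(W, U, V)` from the law under which `W` has the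
same distribution and, given `W`, the variables `U` and `V` are independent with the same
conditional distributions. `klDiv` is in nats, hence the division by `log 2`. -/
def condMutualInfo {Ω 𝒰 𝒱 𝒲 : Type*} [MeasurableSpace Ω]
    [MeasurableSpace 𝒰] [StandardBorelSpace 𝒰] [Nonempty 𝒰]
    [MeasurableSpace 𝒱] [StandardBorelSpace 𝒱] [Nonempty 𝒱] [MeasurableSpace 𝒲]
    (U : Ω → 𝒰) (V : Ω → 𝒱) (W : Ω → 𝒲) (μ : Measure Ω) [IsFiniteMeasure μ] : ℝ≥0∞ :=
  klDiv (μ.map fun ω => (W ω, U ω, V ω))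
    ((μ.map W) ⊗ₘ ((condDistrib U W μ) ×ₖ (condDistrib V W μ))) / ENNReal.ofReal (Real.log 2)

variable {𝒳 𝒴 : Type*} [MeasurableSpace 𝒳] [MeasurableSpace 𝒴]

/-- The set `ℳ(D)`. A `𝒴`-valued random variable `Ŷ` jointly distributed with `(X, Y) ∼ P` is given
by the joint law `π` of `(X, Y, Ŷ)`, whose `(X, Y)`-marginal is `P`; the constraint is
`𝔼 ℓ(Y, Ŷ) ≤ D`. -/
def admissible (ℓ : 𝒴 → 𝒴 → ℝ≥0) (D : ℝ≥0) (P : Measure (𝒳 × 𝒴)) :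
    Set (ProbabilityMeasure (𝒳 × 𝒴 × 𝒴)) :=
  {π | (π : Measure (𝒳 × 𝒴 × 𝒴)).map (fun z => (z.1, z.2.1)) = P ∧
    ∫⁻ z, (ℓ z.2.1 z.2.2 : ℝ≥0∞) ∂(π : Measure (𝒳 × 𝒴 × 𝒴)) ≤ D}

variable [StandardBorelSpace 𝒴] [Nonempty 𝒴]

/-- The conditional rate-distortion function `R_{Y|X}(D, P)`, in bits: the infimum of `I(Y; Ŷ | X)`
over `Ŷ ∈ ℳ(D)` (it is `∞` if `ℳ(D)` is empty). -/
def condRDF (ℓ : 𝒴 → 𝒴 → ℝ≥0) (D : ℝ≥0) (P : Measure (𝒳 × 𝒴)) : ℝ≥0∞ :=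
  ⨅ π ∈ admissible ℓ D P,
    condMutualInfo (fun z : 𝒳 × 𝒴 × 𝒴 => z.2.1) (fun z => z.2.2) (fun z => z.1)
      (π : Measure (𝒳 × 𝒴 × 𝒴))

/-- The conditional distortion-rate function `D_{Y|X}(R, P)`: the inverse of the nonincreasing
function `D ↦ R_{Y|X}(D, P)`, that is, the infimum of the `D ≥ 0` with `R_{Y|X}(D, P) ≤ R`. -/
def condDRF (ℓ : 𝒴 → 𝒴 → ℝ≥0) (R : ℝ≥0) (P : Measure (𝒳 × 𝒴)) : ℝ≥0∞ :=
  ⨅ (D : ℝ≥0) (_ : condRDF ℓ D P ≤ R), (D : ℝ≥0∞)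

/-- `𝔻_{Y|X}(R, 𝒬)`, the supremum of `D_{Y|X}(R, P)` over `P ∈ 𝒬`. -/
def supCondDRF (ℓ : 𝒴 → 𝒴 → ℝ≥0) (R : ℝ≥0) (𝒬 : Set (Measure (𝒳 × 𝒴))) : ℝ≥0∞ :=
  ⨆ P ∈ 𝒬, condDRF ℓ R P

/-- The squared loss `ℓ(y, u) = |y - u|²` on `ℝ`. -/
def squaredLoss (y u : ℝ) : ℝ≥0 := ‖y - u‖₊ ^ 2

/-- The distribution `P_f` on `𝒳 × ℝ` with density `p_f(x, y) = V⁻¹ 𝒩(y; f(x), σ²)`, where `V` is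
the volume of `𝒳 ⊆ ℝᵈ`, with respect to the product of the Lebesgue measure on `𝒳` (the restriction
of that of `ℝᵈ`) and the Lebesgue measure on `ℝ`. -/
def regressionLaw {d : ℕ} (𝒳 : Set (EuclideanSpace ℝ (Fin d))) (σ : ℝ≥0) (f : 𝒳 → ℝ) :
    Measure (𝒳 × ℝ) :=
  ((volume.comap (Subtype.val : 𝒳 → EuclideanSpace ℝ (Fin d))).prod volume).withDensity
    fun p => (volume 𝒳)⁻¹ * gaussianPDF (f p.1) (σ ^ 2) p.2

/-- The family `𝒫 = {P_f : f ∈ ℱ}`. -/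
def regressionFamily {d : ℕ} (𝒳 : Set (EuclideanSpace ℝ (Fin d))) (σ : ℝ≥0)
    (ℱ : Set (𝒳 → ℝ)) : Set (Measure (𝒳 × ℝ)) :=
  regressionLaw 𝒳 σ '' ℱ

end CondRateDistortion

end

/-!
Write `v = σ²` and `D₀ = v 2^{-2R}`. Both bounds rest on one function: for `D > 0`, the logarithm
`g(x, y, u)` of the ratio at `y` of the densities of `𝒩(u, D)` and `𝒩(f x, v)` (`logRatio`). If `ν`
is any law under which `Y ∼ 𝒩(f X, v)` is independent of `Ŷ` given `X`, then `e^g` has `ν`-integral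
`1`, since tilting by it merely replaces the conditional law of `Y` given `(X, Ŷ)` by `𝒩(Ŷ, D)`
(`lintegral_exp_logRatio_mul`). Moreover `g` is quadratic in `y`, so under any coupling whose
`(X, Y)`-marginal is `P_f` its mean is `½ log (v / D) + ½ (1 - d / D)`, where `d` is the distortion
(`integral_logRatio`).

Converse: the Donsker–Varadhan inequality with test function `g` gives `I(Y; Ŷ | X) ≥ ½ log (v / D)`
nats whenever `d ≤ D` (`le_condMutualInfo`), so a rate at most `R` forces `D ≥ D₀`. No differential
entropies, and no absolute continuity of the law of `Ŷ`, are needed.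

Achievability: tilting by `g` the law for which also `Ŷ ∼ 𝒩(f X, v - D)` is the backward Gaussian
channel `Y = Ŷ + 𝒩(0, D)` (`backwardLaw`). It has the right marginal, since Gaussian variances add
under convolution, and distortion exactly `D`; and `g` is its log-likelihood ratio, so its
divergence is the mean of `g`, namely `½ log (v / D)`. At `D = D₀` this is `R` bits. When `R = 0`
the law of `Ŷ` given `X` degenerates to a point mass at `f X`.

Nothing about `X` enters beyond its law being a probability measure (`condDRF_gaussianKernel`).
-/

namespace CondRateDistortion

open Real

/-! ### A variational lower bound for the divergence -/

/-- The easy half of the Donsker–Varadhan formula: the difference between the two sides is the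
divergence of `μ` from the exponentially tilted measure `ν.tilted g`. -/
lemma ofReal_integral_sub_log_le_klDiv {α : Type*} [MeasurableSpace α] (μ ν : Measure α)
    [IsProbabilityMeasure μ] [IsProbabilityMeasure ν] {g : α → ℝ} (hg : Integrable g μ)
    (hexp : Integrable (fun x => exp (g x)) ν) :
    ENNReal.ofReal (∫ x, g x ∂μ - log (∫ x, exp (g x) ∂ν)) ≤ klDiv μ ν := by
  by_cases h : klDiv μ ν = ∞
  · simp [h]
  obtain ⟨hac, hint⟩ := klDiv_ne_top_iff.1 h
  have : IsProbabilityMeasure (ν.tilted g) := isProbabilityMeasure_tilted hexp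
  have h1 := integral_llr_add_sub_measure_univ_nonneg (hac.trans (absolutelyContinuous_tilted hexp))
    (integrable_llr_tilted_right hac hg hint hexp)
  rw [integral_llr_tilted_right hac hg hexp hint] at h1
  rw [klDiv_of_ac_of_integrable hac hint]
  simp only [probReal_univ] at h1 ⊢
  exact ENNReal.ofReal_le_ofReal (by linarith)

lemma klDiv_tilted_self {α : Type*} [MeasurableSpace α] (ν : Measure α) [IsProbabilityMeasure ν]
    {g : α → ℝ} (hexp : Integrable (fun x => exp (g x)) ν) (hg : Integrable g (ν.tilted g)) :
    klDiv (ν.tilted g) ν =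
      ENNReal.ofReal (∫ x, g x ∂(ν.tilted g) - log (∫ x, exp (g x) ∂ν)) := by
  have : IsProbabilityMeasure (ν.tilted g) := isProbabilityMeasure_tilted hexp
  have hac := tilted_absolutelyContinuous ν g
  have h1 : llr (ν.tilted g) ν =ᵐ[ν.tilted g] fun x => g x - log (∫ x, exp (g x) ∂ν) :=
    hac.ae_le (log_rnDeriv_tilted_left_self hexp)
  have h2 : Integrable (llr (ν.tilted g) ν) (ν.tilted g) :=
    (integrable_congr h1).2 (hg.sub (integrable_const _))
  rw [klDiv_of_ac_of_integrable hac h2, integral_congr_ae h1,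
    integral_sub hg (integrable_const _)]
  simp

/-! ### Gaussian kernels -/

variable {α : Type*} [MeasurableSpace α]

/-- The Markov kernel sending `x` to the normal distribution with mean `f x` and variance `v`. -/
noncomputable def gaussianKernel (f : α → ℝ) (hf : Measurable f) (v : ℝ≥0) : Kernel α ℝ where
  toFun x := gaussianReal (f x) v
  measurable' := by
    have : Measurable fun x => gaussianReal.uncurry (f x, v) :=
      measurable_gaussianReal.comp (hf.prodMk measurable_const)
    exact this

lemma gaussianKernel_apply (f : α → ℝ) (hf : Measurable f) (v : ℝ≥0) (x : α) :
    gaussianKernel f hf v x = gaussianReal (f x) v := rfl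

instance (f : α → ℝ) (hf : Measurable f) (v : ℝ≥0) : IsMarkovKernel (gaussianKernel f hf v) :=
  ⟨fun x => by rw [gaussianKernel_apply]; infer_instance⟩

/-- Smoothing `𝒩(m, τ)` by Gaussian noise of variance `D` gives `𝒩(m, τ + D)`. -/
lemma lintegral_lintegral_gaussianReal (m : ℝ) (τ D : ℝ≥0) {h : ℝ → ℝ≥0∞} (hh : Measurable h) :
    ∫⁻ u, ∫⁻ y, h y ∂(gaussianReal u D) ∂(gaussianReal m τ) =
      ∫⁻ y, h y ∂(gaussianReal m (τ + D)) := by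
  have h1 := gaussianReal_conv_gaussianReal (m₁ := m) (m₂ := 0) (v₁ := τ) (v₂ := D)
  rw [add_zero] at h1
  rw [← h1, Measure.lintegral_conv hh]
  refine lintegral_congr fun u => ?_
  have h2 : gaussianReal u D = (gaussianReal 0 D).map (fun z => u + z) := by
    rw [gaussianReal_map_const_add, zero_add]
  rw [h2, lintegral_map hh (by fun_prop)]

lemma lintegral_sq_sub_gaussianReal (m : ℝ) (v : ℝ≥0) :
    ∫⁻ y, ENNReal.ofReal ((y - m) ^ 2) ∂(gaussianReal m v) = v := by
  have h1 : Integrable (fun y => (y - m) ^ 2) (gaussianReal m v) :=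
    ((memLp_id_gaussianReal' 2 (by simp)).sub (memLp_const m)).integrable_sq
  rw [← ofReal_integral_eq_lintegral_ofReal h1 (ae_of_all _ fun y => sq_nonneg _)]
  have h2 := variance_fun_id_gaussianReal (μ := m) (v := v)
  rw [variance_eq_integral (by fun_prop), integral_id_gaussianReal] at h2
  simp [h2]

/-! ### The backward Gaussian channel -/

/-- The logarithm of the ratio at `y` of the densities of `𝒩(u, D)` and `𝒩(m, v)`. -/
noncomputable def logRatio (m : ℝ) (v D : ℝ≥0) (y u : ℝ) : ℝ :=
  log (gaussianPDFReal u D y / gaussianPDFReal m v y)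

lemma logRatio_eq (m : ℝ) {v D : ℝ≥0} (hv : 0 < v) (hD : 0 < D) (y u : ℝ) :
    logRatio m v D y u =
      log (v / D) / 2 + (y - m) ^ 2 / (2 * v) - (y - u) ^ 2 / (2 * D) := by
  have hv' : (0 : ℝ) < v := hv
  have hD' : (0 : ℝ) < D := hD
  have hp : (0 : ℝ) < 2 * π := by positivity
  rw [logRatio, log_div (gaussianPDFReal_pos _ _ _ hD.ne').ne'
    (gaussianPDFReal_pos _ _ _ hv.ne').ne']
  simp only [gaussianPDFReal]
  rw [log_mul (by positivity) (exp_pos _).ne', log_mul (by positivity) (exp_pos _).ne', log_exp,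
    log_exp, log_inv, log_inv, log_sqrt (by positivity), log_sqrt (by positivity),
    log_mul hp.ne' hv'.ne', log_mul hp.ne' hD'.ne', log_div hv'.ne' hD'.ne']
  ring

lemma ofReal_exp_logRatio_mul_gaussianPDF (m : ℝ) {v D : ℝ≥0} (hv : 0 < v) (hD : 0 < D)
    (y u : ℝ) :
    gaussianPDF m v y * ENNReal.ofReal (exp (logRatio m v D y u)) = gaussianPDF u D y := by
  have h1 := gaussianPDFReal_pos m v y hv.ne'
  have h2 := gaussianPDFReal_pos u D y hD.ne'
  rw [logRatio, exp_log (by positivity), gaussianPDF, gaussianPDF,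
    ← ENNReal.ofReal_mul h1.le, mul_div_cancel₀ _ h1.ne']

lemma measurable_logRatio {f : α → ℝ} (hf : Measurable f) (v D : ℝ≥0) :
    Measurable fun z : α × ℝ × ℝ => logRatio (f z.1) v D z.2.1 z.2.2 := by
  have h (w : ℝ≥0) (a b : α × ℝ × ℝ → ℝ) (ha : Measurable a) (hb : Measurable b) :
      Measurable fun z => gaussianPDFReal (a z) w (b z) :=
    measurable_uncurry_gaussianPDFReal.comp (ha.prodMk (measurable_const.prodMk hb))
  exact ((h D _ _ (by fun_prop) (by fun_prop)).div
    (h v _ _ (by fun_prop) (by fun_prop))).log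

lemma measurable_ofReal_exp_logRatio {f : α → ℝ} (hf : Measurable f) (v D : ℝ≥0) :
    Measurable fun z : α × ℝ × ℝ => ENNReal.ofReal (exp (logRatio (f z.1) v D z.2.1 z.2.2)) := by
  have h := measurable_logRatio hf v D
  fun_prop

variable (U : Measure α) [IsProbabilityMeasure U] {f : α → ℝ} (hf : Measurable f)

/-- Integration against the law for which, given `x`, the coordinates `y ∼ κ x` and `u ∼ η x` are
independent, with `y` integrated first. -/
lemma lintegral_compProd_prod_symm (κ η : Kernel α ℝ) [IsMarkovKernel κ] [IsMarkovKernel η]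
    {h : α × ℝ × ℝ → ℝ≥0∞} (hh : Measurable h) :
    ∫⁻ z, h z ∂(U ⊗ₘ (κ ×ₖ η)) = ∫⁻ x, ∫⁻ u, ∫⁻ y, h (x, y, u) ∂(κ x) ∂(η x) ∂U := by
  rw [Measure.lintegral_compProd hh]
  refine lintegral_congr fun x => ?_
  rw [Kernel.prod_apply, lintegral_prod_symm _ (by fun_prop)]

/-- Weighting the law under which `Y ∼ 𝒩(f x, v)` and `Ŷ ∼ η x` are independent given `X = x` by
the density ratio turns the conditional law of `Y` given `(X, Ŷ) = (x, u)` into `𝒩(u, D)`. -/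
lemma lintegral_exp_logRatio_mul (η : Kernel α ℝ) [IsMarkovKernel η] {v D : ℝ≥0} (hv : 0 < v)
    (hD : 0 < D) {h : α × ℝ × ℝ → ℝ≥0∞} (hh : Measurable h) :
    ∫⁻ z, ENNReal.ofReal (exp (logRatio (f z.1) v D z.2.1 z.2.2)) * h z
        ∂(U ⊗ₘ (gaussianKernel f hf v ×ₖ η)) =
      ∫⁻ x, ∫⁻ u, ∫⁻ y, h (x, y, u) ∂(gaussianReal u D) ∂(η x) ∂U := by
  have hm : Measurable fun z : α × ℝ × ℝ =>
      ENNReal.ofReal (exp (logRatio (f z.1) v D z.2.1 z.2.2)) * h z := by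
    have hL := measurable_ofReal_exp_logRatio hf v D
    fun_prop
  rw [lintegral_compProd_prod_symm U _ η hm]
  refine lintegral_congr fun x => lintegral_congr fun u => ?_
  have hmu : Measurable fun y => ENNReal.ofReal (exp (logRatio (f x) v D y u)) * h (x, y, u) :=
    hm.comp (g := fun z => ENNReal.ofReal (exp (logRatio (f z.1) v D z.2.1 z.2.2)) * h z)
      (f := fun y => (x, y, u)) (by fun_prop)
  have hhu : Measurable fun y => h (x, y, u) := by fun_prop
  rw [gaussianKernel_apply, gaussianReal_of_var_ne_zero _ hv.ne',
    gaussianReal_of_var_ne_zero _ hD.ne',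
    lintegral_withDensity_eq_lintegral_mul _ (measurable_gaussianPDF _ _) hmu,
    lintegral_withDensity_eq_lintegral_mul _ (measurable_gaussianPDF _ _) hhu]
  refine lintegral_congr fun y => ?_
  simp only [Pi.mul_apply]
  rw [← mul_assoc, ofReal_exp_logRatio_mul_gaussianPDF _ hv hD]

lemma lintegral_exp_logRatio (η : Kernel α ℝ) [IsMarkovKernel η] {v D : ℝ≥0} (hv : 0 < v)
    (hD : 0 < D) :
    ∫⁻ z, ENNReal.ofReal (exp (logRatio (f z.1) v D z.2.1 z.2.2))
        ∂(U ⊗ₘ (gaussianKernel f hf v ×ₖ η)) = 1 := by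
  simpa using lintegral_exp_logRatio_mul U hf η hv hD (h := fun _ => 1) measurable_const

lemma integrable_exp_logRatio (η : Kernel α ℝ) [IsMarkovKernel η] {v D : ℝ≥0} (hv : 0 < v)
    (hD : 0 < D) :
    Integrable (fun z => exp (logRatio (f z.1) v D z.2.1 z.2.2))
        (U ⊗ₘ (gaussianKernel f hf v ×ₖ η)) := by
  have hm : Measurable fun z : α × ℝ × ℝ => exp (logRatio (f z.1) v D z.2.1 z.2.2) :=
    measurable_exp.comp (measurable_logRatio hf v D)
  refine (lintegral_ofReal_ne_top_iff_integrable hm.aestronglyMeasurable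
    (ae_of_all _ fun _ => (exp_pos _).le)).1 ?_
  rw [lintegral_exp_logRatio U hf η hv hD]
  simp

lemma integral_exp_logRatio (η : Kernel α ℝ) [IsMarkovKernel η] {v D : ℝ≥0} (hv : 0 < v)
    (hD : 0 < D) :
    ∫ z, exp (logRatio (f z.1) v D z.2.1 z.2.2)
        ∂(U ⊗ₘ (gaussianKernel f hf v ×ₖ η)) = 1 := by
  rw [integral_eq_lintegral_of_nonneg_ae (ae_of_all _ fun _ => (exp_pos _).le)
    (integrable_exp_logRatio U hf η hv hD).1, lintegral_exp_logRatio U hf η hv hD]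
  simp

/-! ### Couplings with a Gaussian regression law -/

lemma coe_squaredLoss (y u : ℝ) : (squaredLoss y u : ℝ≥0∞) = ENNReal.ofReal ((y - u) ^ 2) := by
  rw [ENNReal.ofReal, ENNReal.coe_inj]
  ext
  simp [squaredLoss, sq_nonneg]

variable {U hf}

lemma lintegral_sq_sub_regression {ρ : Measure (α × ℝ × ℝ)} {v : ℝ≥0}
    (hρ : ρ.map (fun z => (z.1, z.2.1)) = U ⊗ₘ gaussianKernel f hf v) :
    ∫⁻ z, ENNReal.ofReal ((z.2.1 - f z.1) ^ 2) ∂ρ = v := by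
  have h1 : Measurable fun p : α × ℝ => ENNReal.ofReal ((p.2 - f p.1) ^ 2) := by fun_prop
  have h2 := lintegral_map (μ := ρ) h1
    (show Measurable fun z : α × ℝ × ℝ => (z.1, z.2.1) by fun_prop)
  rw [← h2, hρ, Measure.lintegral_compProd h1]
  simp [gaussianKernel_apply, lintegral_sq_sub_gaussianReal]

/-- Under a coupling of `(X, Y, Ŷ)` with finite distortion `d`, the density-ratio exponent is
integrable, with mean `½ log (v / D) + ½ (1 - d / D)`. -/
lemma integral_logRatio {ρ : Measure (α × ℝ × ℝ)} [IsProbabilityMeasure ρ] {v D d : ℝ≥0}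
    (hv : 0 < v) (hD : 0 < D)
    (hρ : ρ.map (fun z => (z.1, z.2.1)) = U ⊗ₘ gaussianKernel f hf v)
    (hd : ∫⁻ z, (squaredLoss z.2.1 z.2.2 : ℝ≥0∞) ∂ρ = d) :
    Integrable (fun z => logRatio (f z.1) v D z.2.1 z.2.2) ρ ∧
      ∫ z, logRatio (f z.1) v D z.2.1 z.2.2 ∂ρ =
        log (v / D) / 2 + (1 - d / D) / 2 := by
  have key (F : α × ℝ × ℝ → ℝ) (hF : Measurable F) (c : ℝ≥0)
      (hc : ∫⁻ z, ENNReal.ofReal (F z ^ 2) ∂ρ = c) :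
      Integrable (fun z => F z ^ 2) ρ ∧ ∫ z, F z ^ 2 ∂ρ = c := by
    have h0 : 0 ≤ᵐ[ρ] fun z => F z ^ 2 := ae_of_all _ fun z => sq_nonneg _
    have hm : AEStronglyMeasurable (fun z => F z ^ 2) ρ :=
      (hF.pow_const 2).aestronglyMeasurable
    refine ⟨(lintegral_ofReal_ne_top_iff_integrable hm h0).1 (by simp [hc]), ?_⟩
    rw [integral_eq_lintegral_of_nonneg_ae h0 hm, hc]
    simp
  simp only [coe_squaredLoss] at hd
  obtain ⟨i1, e1⟩ := key (fun z => z.2.1 - f z.1) (by fun_prop) v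
    (lintegral_sq_sub_regression hρ)
  obtain ⟨i2, e2⟩ := key (fun z => z.2.1 - z.2.2) (by fun_prop) d hd
  have i3 : Integrable (fun z : α × ℝ × ℝ => log (v / D) / 2 + (z.2.1 - f z.1) ^ 2 / (2 * v)) ρ :=
    (integrable_const _).add (i1.div_const _)
  simp only [logRatio_eq _ hv hD]
  refine ⟨i3.sub (i2.div_const _), ?_⟩
  rw [integral_sub i3 (i2.div_const _), integral_add (integrable_const _) (i1.div_const _),
    integral_div (2 * (v : ℝ)), integral_div (2 * (D : ℝ)), e1, e2]
  have hv' : (v : ℝ) ≠ 0 := by exact_mod_cast hv.ne'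
  have hD' : (D : ℝ) ≠ 0 := by exact_mod_cast hD.ne'
  simp
  field_simp
  ring

lemma map_fst_eq {ρ : Measure (α × ℝ × ℝ)} {κ : Kernel α ℝ} [IsMarkovKernel κ]
    (hρ : ρ.map (fun z => (z.1, z.2.1)) = U ⊗ₘ κ) : ρ.map (fun z => z.1) = U := by
  have h := congrArg (fun m => Measure.map Prod.fst m) hρ
  rw [Measure.map_map measurable_fst (by fun_prop)] at h
  rw [← Measure.fst, Measure.fst_compProd] at h
  exact h

/-- The conditional mutual information only involves the conditional law of `Y` given `X` through
the law of `(X, Y)`. -/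
lemma condMutualInfo_eq {ρ : Measure (α × ℝ × ℝ)} [IsFiniteMeasure ρ] {κ η : Kernel α ℝ}
    [IsMarkovKernel κ] [IsMarkovKernel η]
    (hκ : ρ.map (fun z => (z.1, z.2.1)) = U ⊗ₘ κ)
    (hη : condDistrib (fun z : α × ℝ × ℝ => z.2.2) (fun z => z.1) ρ =ᵐ[U] η) :
    condMutualInfo (fun z : α × ℝ × ℝ => z.2.1) (fun z => z.2.2) (fun z => z.1) ρ =
      klDiv ρ (U ⊗ₘ (κ ×ₖ η)) / ENNReal.ofReal (log 2) := by
  have hU := map_fst_eq hκ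
  have h1 : condDistrib (fun z : α × ℝ × ℝ => z.2.1) (fun z => z.1) ρ =ᵐ[U] κ := by
    have := condDistrib_ae_eq_of_measure_eq_compProd (μ := ρ) (fun z : α × ℝ × ℝ => z.1)
      (Y := fun z => z.2.1) (by fun_prop) (κ := κ) (by rw [hU, hκ])
    rwa [hU] at this
  have h2 : ρ.map (fun z : α × ℝ × ℝ => (z.1, z.2.1, z.2.2)) = ρ := Measure.map_id
  rw [condMutualInfo, h2, hU]
  congr 2
  refine Measure.compProd_congr ?_
  filter_upwards [h1, hη] with x hx1 hx2
  rw [Kernel.prod_apply, Kernel.prod_apply, hx1, hx2]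

/-- The Shannon lower bound for a Gaussian regression law. -/
lemma le_condMutualInfo {ρ : Measure (α × ℝ × ℝ)} [IsProbabilityMeasure ρ] {v D : ℝ≥0}
    (hv : 0 < v) (hD : 0 < D)
    (hρ : ρ.map (fun z => (z.1, z.2.1)) = U ⊗ₘ gaussianKernel f hf v)
    (hd : ∫⁻ z, (squaredLoss z.2.1 z.2.2 : ℝ≥0∞) ∂ρ ≤ D) :
    ENNReal.ofReal (log (v / D) / 2) / ENNReal.ofReal (log 2) ≤
      condMutualInfo (fun z : α × ℝ × ℝ => z.2.1) (fun z => z.2.2) (fun z => z.1) ρ := by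
  rw [condMutualInfo_eq hρ (Filter.EventuallyEq.refl _ _)]
  gcongr
  obtain ⟨d, hd'⟩ := WithTop.ne_top_iff_exists.1 (hd.trans_lt ENNReal.coe_lt_top).ne
  change (d : ℝ≥0∞) = _ at hd'
  rw [← hd', ENNReal.coe_le_coe] at hd
  obtain ⟨i, e⟩ := integral_logRatio (U := U) (hf := hf) hv hD hρ hd'.symm
  refine le_trans ?_ (ofReal_integral_sub_log_le_klDiv ρ _ i (integrable_exp_logRatio U hf _ hv hD))
  rw [integral_exp_logRatio U hf _ hv hD, e, log_one, sub_zero]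
  refine ENNReal.ofReal_le_ofReal ?_
  have : (d : ℝ) / D ≤ 1 := div_le_one_of_le₀ (by exact_mod_cast hd) D.2
  linarith

variable (U hf)

/-- The law of `(X, Y, Ŷ)` in which `X ∼ U`, `Ŷ ∼ 𝒩(f X, v - D)` and `Y ∼ 𝒩(Ŷ, D)` given
`(X, Ŷ)`, written as a tilting of the law for which `Y` and `Ŷ` are independent given `X`. -/
noncomputable def backwardLaw (v D : ℝ≥0) : Measure (α × ℝ × ℝ) :=
  (U ⊗ₘ (gaussianKernel f hf v ×ₖ gaussianKernel f hf (v - D))).tilted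
    fun z => logRatio (f z.1) v D z.2.1 z.2.2

lemma isProbabilityMeasure_backwardLaw {v D : ℝ≥0} (hv : 0 < v) (hD : 0 < D) :
    IsProbabilityMeasure (backwardLaw U hf v D) :=
  isProbabilityMeasure_tilted (integrable_exp_logRatio U hf _ hv hD)

lemma lintegral_backwardLaw {v D : ℝ≥0} (hv : 0 < v) (hD : 0 < D) {h : α × ℝ × ℝ → ℝ≥0∞}
    (hh : Measurable h) :
    ∫⁻ z, h z ∂(backwardLaw U hf v D) =
      ∫⁻ x, ∫⁻ u, ∫⁻ y, h (x, y, u) ∂(gaussianReal u D) ∂(gaussianReal (f x) (v - D)) ∂U := by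
  rw [backwardLaw, lintegral_tilted, integral_exp_logRatio U hf _ hv hD]
  simp only [div_one]
  exact lintegral_exp_logRatio_mul U hf _ hv hD hh

lemma map_backwardLaw_fst_snd {v D : ℝ≥0} (hD : 0 < D) (hDv : D ≤ v) :
    (backwardLaw U hf v D).map (fun z => (z.1, z.2.1)) = U ⊗ₘ gaussianKernel f hf v := by
  refine Measure.ext_of_lintegral _ fun h hh => ?_
  rw [lintegral_map hh (by fun_prop), lintegral_backwardLaw U hf (hD.trans_le hDv) hD
    (by fun_prop), Measure.lintegral_compProd hh]
  refine lintegral_congr fun x => ?_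
  rw [lintegral_lintegral_gaussianReal (f x) (v - D) D (h := fun y => h (x, y)) (by fun_prop),
    tsub_add_cancel_of_le hDv, gaussianKernel_apply]

lemma map_backwardLaw_fst_thd {v D : ℝ≥0} (hv : 0 < v) (hD : 0 < D) :
    (backwardLaw U hf v D).map (fun z => (z.1, z.2.2)) = U ⊗ₘ gaussianKernel f hf (v - D) := by
  refine Measure.ext_of_lintegral _ fun h hh => ?_
  rw [lintegral_map hh (by fun_prop), lintegral_backwardLaw U hf hv hD
    (by fun_prop), Measure.lintegral_compProd hh]
  simp [gaussianKernel_apply]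

lemma lintegral_squaredLoss_backwardLaw {v D : ℝ≥0} (hv : 0 < v) (hD : 0 < D) :
    ∫⁻ z, (squaredLoss z.2.1 z.2.2 : ℝ≥0∞) ∂(backwardLaw U hf v D) = D := by
  simp only [coe_squaredLoss]
  rw [lintegral_backwardLaw U hf hv hD (by fun_prop)]
  simp [lintegral_sq_sub_gaussianReal]

lemma condMutualInfo_backwardLaw {v D : ℝ≥0} (hD : 0 < D) (hDv : D ≤ v)
    [IsFiniteMeasure (backwardLaw U hf v D)] :
    condMutualInfo (fun z : α × ℝ × ℝ => z.2.1) (fun z => z.2.2) (fun z => z.1)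
        (backwardLaw U hf v D) =
      ENNReal.ofReal (log (v / D) / 2) / ENNReal.ofReal (log 2) := by
  have hv := hD.trans_le hDv
  have := isProbabilityMeasure_backwardLaw U hf hv hD
  have h12 := map_backwardLaw_fst_snd U hf hD hDv
  have hU := map_fst_eq h12
  have hη := condDistrib_ae_eq_of_measure_eq_compProd (μ := backwardLaw U hf v D)
    (fun z : α × ℝ × ℝ => z.1) (Y := fun z => z.2.2) (by fun_prop)
    (κ := gaussianKernel f hf (v - D)) (by rw [hU, map_backwardLaw_fst_thd U hf hv hD])
  rw [hU] at hη
  rw [condMutualInfo_eq h12 hη]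
  obtain ⟨i, e⟩ := integral_logRatio (D := D) hv hD h12
    (lintegral_squaredLoss_backwardLaw U hf hv hD)
  congr 1
  have h := klDiv_tilted_self _ (integrable_exp_logRatio U hf (gaussianKernel f hf (v - D)) hv hD) i
  rw [integral_exp_logRatio U hf _ hv hD] at h
  refine h.trans ?_
  change ENNReal.ofReal (∫ z, logRatio (f z.1) v D z.2.1 z.2.2 ∂(backwardLaw U hf v D) - _) = _
  have hD' : (D : ℝ) ≠ 0 := by exact_mod_cast hD.ne'
  rw [e, div_self hD']
  simp

/-! ### The conditional distortion-rate function -/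

/-- The conditional distortion-rate function of a Gaussian regression law with noise variance `v`,
for an arbitrary distribution of the covariate. -/
lemma condDRF_gaussianKernel {v : ℝ≥0} (hv : 0 < v) (R : ℝ≥0) :
    condDRF squaredLoss R (U ⊗ₘ gaussianKernel f hf v) =
      ENNReal.ofReal ((v : ℝ) * (2 : ℝ) ^ (-2 * (R : ℝ))) := by
  have hlog : 0 < log 2 := log_pos one_lt_two
  have hv' : (0 : ℝ) < v := hv
  have h2R : (0 : ℝ) < (2 : ℝ) ^ (-2 * (R : ℝ)) := by positivity
  obtain ⟨D₀, hD₀⟩ : ∃ D₀ : ℝ≥0, (D₀ : ℝ) = v * (2 : ℝ) ^ (-2 * (R : ℝ)) :=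
    ⟨⟨_, by positivity⟩, rfl⟩
  have hD₀pos : 0 < D₀ := by
    rw [← NNReal.coe_pos, hD₀]; positivity
  have hlogD : log (v / D₀) / 2 = R * log 2 := by
    rw [hD₀, log_div hv'.ne' (by positivity), log_mul hv'.ne' h2R.ne', log_rpow two_pos]
    ring
  rw [← hD₀, ENNReal.ofReal_coe_nnreal]
  apply le_antisymm
  · have hDv : D₀ ≤ v := by
      rw [← NNReal.coe_le_coe, hD₀]
      exact mul_le_of_le_one_right hv'.le (rpow_le_one_of_one_le_of_nonpos one_le_two
        (by have := R.2; simp))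
    have := isProbabilityMeasure_backwardLaw U hf hv hD₀pos
    have hmem : (⟨backwardLaw U hf v D₀, this⟩ : ProbabilityMeasure (α × ℝ × ℝ)) ∈
        admissible squaredLoss D₀ (U ⊗ₘ gaussianKernel f hf v) :=
      ⟨map_backwardLaw_fst_snd U hf hD₀pos hDv,
        (lintegral_squaredLoss_backwardLaw U hf hv hD₀pos).le⟩
    have hR : condRDF squaredLoss D₀ (U ⊗ₘ gaussianKernel f hf v) ≤ R := by
      refine (iInf₂_le _ hmem).trans_eq ((condMutualInfo_backwardLaw U hf hD₀pos hDv).trans ?_)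
      rw [hlogD, ENNReal.ofReal_mul R.coe_nonneg, ENNReal.ofReal_coe_nnreal]
      exact ENNReal.mul_div_cancel_right (by simpa using hlog) ENNReal.ofReal_ne_top
    exact iInf₂_le D₀ hR
  · refine le_iInf₂ fun D hD => ENNReal.coe_le_coe.2 ?_
    -- The lower bound needs a positive distortion level, whereas `D` may vanish.
    refine le_of_forall_pos_le_add fun ε hε => ?_
    have hpos : 0 < D + ε := by positivity
    have h1 : ENNReal.ofReal (log (v / (D + ε : ℝ≥0)) / 2) / ENNReal.ofReal (log 2) ≤ R := by
      refine le_trans (le_iInf₂ fun ρ hρ => ?_) hD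
      refine le_condMutualInfo hv hpos hρ.1 (hρ.2.trans ?_)
      exact_mod_cast le_self_add
    rw [ENNReal.div_le_iff (by simpa using hlog) ENNReal.ofReal_ne_top,
      ← ENNReal.ofReal_coe_nnreal (p := R), ← ENNReal.ofReal_mul R.coe_nonneg,
      ENNReal.ofReal_le_ofReal_iff (by have := R.2; positivity), ← hlogD] at h1
    have hD₀' : (0 : ℝ) < D₀ := hD₀pos
    have hp' : (0 : ℝ) < (D + ε : ℝ≥0) := hpos
    have h2 : (v : ℝ) / (D + ε : ℝ≥0) ≤ v / D₀ :=
      (log_le_log_iff (by positivity) (by positivity)).1 (by linarith)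
    exact_mod_cast (div_le_div_iff_of_pos_left hv' hp' hD₀').1 h2

/-! ### Uniform covariates on a compact set -/

variable {d : ℕ} {𝒳 : Set (EuclideanSpace ℝ (Fin d))}

/-- The uniform distribution on `𝒳`, as a measure on the subtype. -/
noncomputable def uniformLaw (𝒳 : Set (EuclideanSpace ℝ (Fin d))) : Measure 𝒳 :=
  (volume 𝒳)⁻¹ • volume.comap (Subtype.val : 𝒳 → EuclideanSpace ℝ (Fin d))

lemma isProbabilityMeasure_uniformLaw (h𝒳 : IsCompact 𝒳) (hV : 0 < volume 𝒳) :
    IsProbabilityMeasure (uniformLaw 𝒳) := by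
  constructor
  rw [uniformLaw, Measure.smul_apply,
    (MeasurableEmbedding.subtype_coe h𝒳.measurableSet).comap_apply]
  simpa using ENNReal.inv_mul_cancel hV.ne' h𝒳.measure_lt_top.ne

lemma regressionLaw_eq (h𝒳 : IsCompact 𝒳) (hV : 0 < volume 𝒳) {σ : ℝ≥0} (hσ : 0 < σ)
    {f : 𝒳 → ℝ} (hf : Measurable f) :
    regressionLaw 𝒳 σ f = uniformLaw 𝒳 ⊗ₘ gaussianKernel f hf (σ ^ 2) := by
  have := isProbabilityMeasure_uniformLaw h𝒳 hV
  have : IsFiniteMeasure (volume.comap (Subtype.val : 𝒳 → EuclideanSpace ℝ (Fin d))) := by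
    constructor
    rw [(MeasurableEmbedding.subtype_coe h𝒳.measurableSet).comap_apply]
    simpa using h𝒳.measure_lt_top
  have hpdf : Measurable fun p : 𝒳 × ℝ => gaussianPDF (f p.1) (σ ^ 2) p.2 :=
    measurable_uncurry_gaussianPDF.comp
      ((hf.comp measurable_fst).prodMk (measurable_const.prodMk measurable_snd))
  refine Measure.ext_of_lintegral _ fun h hh => ?_
  rw [Measure.lintegral_compProd hh, regressionLaw,
    lintegral_withDensity_eq_lintegral_mul _ (by fun_prop) hh,
    lintegral_prod _ (by fun_prop), uniformLaw, lintegral_smul_measure, smul_eq_mul,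
    ← lintegral_const_mul' _ _ (by simpa using hV.ne')]
  refine lintegral_congr fun x => ?_
  rw [gaussianKernel_apply, gaussianReal_of_var_ne_zero _ (by positivity),
    lintegral_withDensity_eq_lintegral_mul _ (measurable_gaussianPDF _ _) (by fun_prop),
    ← lintegral_const_mul' _ _ (by simpa using hV.ne')]
  simp [mul_assoc]

end CondRateDistortion

theorem mainTheorem4 {d : ℕ} (𝒳 : Set (EuclideanSpace ℝ (Fin d)))
    (h𝒳 : IsCompact 𝒳) (hV : 0 < volume 𝒳)
    (ℱ : Set (𝒳 → ℝ)) (hℱ : ℱ.Nonempty) (hmeas : ∀ f ∈ ℱ, Measurable f)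
    (hrange : ∀ f ∈ ℱ, ∀ x, f x ∈ Set.Icc (0 : ℝ) 1)
    (σ : ℝ≥0) (hσ : 0 < σ) (R : ℝ≥0) :
    (∀ f ∈ ℱ, CondRateDistortion.condDRF CondRateDistortion.squaredLoss R
        (CondRateDistortion.regressionLaw 𝒳 σ f) =
      ENNReal.ofReal ((σ : ℝ) ^ 2 * (2 : ℝ) ^ (-2 * (R : ℝ)))) ∧
    CondRateDistortion.supCondDRF CondRateDistortion.squaredLoss R
        (CondRateDistortion.regressionFamily 𝒳 σ ℱ) =
      ENNReal.ofReal ((σ : ℝ) ^ 2 * (2 : ℝ) ^ (-2 * (R : ℝ))) := by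
  have key : ∀ f ∈ ℱ, CondRateDistortion.condDRF CondRateDistortion.squaredLoss R
        (CondRateDistortion.regressionLaw 𝒳 σ f) =
      ENNReal.ofReal ((σ : ℝ) ^ 2 * (2 : ℝ) ^ (-2 * (R : ℝ))) := by
    intro f hf
    have := CondRateDistortion.isProbabilityMeasure_uniformLaw h𝒳 hV
    rw [CondRateDistortion.regressionLaw_eq h𝒳 hV hσ (hmeas f hf),
      CondRateDistortion.condDRF_gaussianKernel _ _ (by positivity)]
    simp
  refine ⟨key, ?_⟩
  rw [CondRateDistortion.supCondDRF, CondRateDistortion.regressionFamily, iSup_image,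
    biSup_congr key, biSup_const hℱ]
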